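/- Consider the following voting model. There are two worlds \(L,H\), with prior probabilities \(P_L,P_H>0\), \(P_L+P_H=1\), and two alternatives \(\mathbf A,\mathbf R\). Given the world \(W\), each of \(T\) agents (\(T\) odd) independently receives a signal \(\ell\) or \(h\), with probabilities \(P_{\ell W},P_{hW}\), where \(P_{\ell L}>P_{\ell H}\) and \(P_{hH}>P_{hL}\). Each agent has one of three types: friendly (\(F\)), unfriendly (\(U\)) or contingent (\(C\)). An agent of type \(a\) has a utility function \(v_a(w,x)\in\{0,1,\ldots,B\}\) of the world \(w\) and the alternative \(x\) chosen, with \(v_a(H,\mathbf A)>v_a(L,\mathbf A)\) and \(v_a(L,\mathbf R)>v_a(H,\mathbf R)\); type \(F\) strictly prefers \(\mathbf A\) in both worlds, type \(U\) strictly prefers \(\mathbf R\) in both worlds, and type \(C\) strictly prefers \(\mathbf R\) in \(L\) and \(\mathbf A\) in \(H\). The vector of fractions \((\alpha_F,\alpha_U,\alpha_C)\) of agents of each type is not known but is drawn, independently of world and signals, from a common prior \(\mathcal D\) on the simplex \(\Delta_3\); given the fractions, the types are assigned to the agents uniformly at random, and each agent learns only his own type and signal. The parameters \((P_L,P_H)\),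 the signal probabilities, \(v_F,v_U,v_C\) and \(\mathcal D\) do not depend on \(T\); a number \(T\) of agents is called feasible if \(\alpha_FT,\alpha_UT,\alpha_CT\) are integers for all vectors in the support of \(\mathcal D\). A (possibly randomized) mechanism collects a report from each agent, in an arbitrary measurable space \(\mathcal R\) of reports, and outputs \(\mathbf A\) or \(\mathbf R\); it is anonymous if permuting the reports does not change the output (for a randomized mechanism, its distribution). A (mixed) strategy maps the agent's own type and signal to a random report, and reports are drawn independently across agents; a strategy profile \(\Sigma\) is symmetric if all agents use the same strategy. For an agent \(t\) and a type \(a\) that \(t\) has with positive probability, let \(u_{t,a}(\Sigma)\) be the expected utility of \(t\) given that \(t\) has type \(a\). The profile \(\Sigma\) is an \(\varepsilon\)-strong Bayes Nash equilibrium if there are no set \(D\) of pairs (agent, type), each of positive probability, and no profile \(\Sigma'\) such that the agents' strategies in \(\Sigma\) and \(\Sigma'\) agree at all pairs outside \(D\), \(u_{t,a}(\Sigma')\ge u_{t,a}(\Sigma)\) for all \((t,a)\in D\), and \(u_{t,a}(\Sigma')>u_{t,a}(\Sigma)+\varepsilon\) for some \((t,a)\in D\). The majority wish is the alternative that more than half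 of the agents prefer in the actual world. Theorem. There are a constant \(\tau>0\) and parameters \((P_L,P_H)\), \((P_{\ell L},P_{hL},P_{\ell H},P_{hH})\), \(v_F,v_U,v_C,\mathcal D\) of the model, with infinitely many feasible odd \(T\), such that for every feasible odd \(T\), every anonymous mechanism for \(T\) agents, and every symmetric strategy profile \(\Sigma\) that is a \(\tau\)-strong Bayes Nash equilibrium under the mechanism, the probability that the mechanism outputs the majority wish under \(\Sigma\) is at most \(1-\tau\). -/

import Mathlib

open MeasureTheory

noncomputable section

namespace Voting

/-- The two worlds: low quality and high quality. -/
inductive World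
  | L
  | H
  deriving DecidableEq

instance : Fintype World := ⟨{World.L, World.H}, by intro x; cases x <;> simp⟩

/-- The two private signals (`lo` is the signal for `L`, `hi` the signal for `H`). -/
inductive Signal
  | lo
  | hi
  deriving DecidableEq

instance : Fintype Signal := ⟨{Signal.lo, Signal.hi}, by intro x; cases x <;> simp⟩

/-- The possible outcomes, i.e. the two alternatives: accept and reject. -/
inductive Outcome
  | A
  | R
  deriving DecidableEq

instance : Fintype Outcome := ⟨{Outcome.A, Outcome.R}, by intro x; cases x <;> simp⟩

/-- Candidate-friendly, candidate-unfriendly and contingent agents. -/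
inductive AgentType
  | F
  | U
  | C
  deriving DecidableEq

instance : Fintype AgentType := ⟨{AgentType.F, AgentType.U, AgentType.C}, by intro x; cases x <;> simp⟩

/-- The parameters of the voting model with an unknown distribution of agent types. They do not
involve the number of agents. All agents of one type share a utility function, with values in `ℕ`
(hence bounded by some `B`, there being finitely many values). -/
structure Setting where
  /-- Common prior over the worlds. -/
  worldProb : World → ℝ
  worldProb_pos : ∀ w, 0 < worldProb w
  worldProb_sum : ∑ w, worldProb w = 1
  /-- `signalProb w m` is the probability that an agent receives signal `m` in world `w`. -/
  signalProb : World → Signal → ℝ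
  signalProb_nonneg : ∀ w m, 0 ≤ signalProb w m
  signalProb_sum : ∀ w, ∑ m, signalProb w m = 1
  /-- Signals are positively correlated with the worlds. -/
  corr_lo : signalProb World.H Signal.lo < signalProb World.L Signal.lo
  corr_hi : signalProb World.L Signal.hi < signalProb World.H Signal.hi
  /-- `value a w x` is the ex-post utility of a type `a` agent if `x` is chosen in world `w`. -/
  value : AgentType → World → Outcome → ℕ
  value_A : ∀ a, value a World.L Outcome.A < value a World.H Outcome.A
  value_R : ∀ a, value a World.H Outcome.R < value a World.L Outcome.R
  /-- Friendly agents prefer `A` in both worlds. -/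
  friendly : value AgentType.F World.L Outcome.R < value AgentType.F World.L Outcome.A
  /-- Unfriendly agents prefer `R` in both worlds. -/
  unfriendly : value AgentType.U World.H Outcome.A < value AgentType.U World.H Outcome.R
  /-- Contingent agents prefer `R` in world `L` and `A` in world `H`. -/
  contingent_L : value AgentType.C World.L Outcome.A < value AgentType.C World.L Outcome.R
  contingent_H : value AgentType.C World.H Outcome.R < value AgentType.C World.H Outcome.A
  /-- Common prior over the vector of fractions of agents of the three types. -/
  typePrior : PMF (AgentType → ℝ)
  typePrior_mem : ∀ α ∈ typePrior.support, α ∈ stdSimplex ℝ AgentType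

/-- A (possibly randomized) mechanism for `T` agents with reports in `R`: to each collection of
reports it assigns the probability of outputting `A`; otherwise it outputs `R`. A deterministic
mechanism is one where this probability only takes the values `0` and `1`. -/
structure Mechanism (T : ℕ) (R : Type*) [MeasurableSpace R] where
  acceptProb : (Fin T → R) → ℝ
  measurable_acceptProb : Measurable acceptProb
  acceptProb_mem : ∀ r, acceptProb r ∈ Set.Icc (0 : ℝ) 1

/-- The outcome of an anonymous mechanism does not change when the reports are permuted. -/
def Mechanism.Anonymous {T : ℕ} {R : Type*} [MeasurableSpace R] (M : Mechanism T R) : Prop :=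
  ∀ (π : Equiv.Perm (Fin T)) (r : Fin T → R), M.acceptProb (fun t => r (π t)) = M.acceptProb r

/-- A mixed strategy: the law of the report, depending on the agent's own type and signal. -/
abbrev Strategy (R : Type*) [MeasurableSpace R] := AgentType → Signal → ProbabilityMeasure R

/-- A strategy profile is symmetric if all agents use the same strategy. -/
def IsSymmetric {T : ℕ} {R : Type*} [MeasurableSpace R] (σ : Fin T → Strategy R) : Prop :=
  ∀ t t', σ t = σ t'

/-- Probability that `A` is output, given the types and the signals of all agents. Reports are
drawn independently. -/
def acceptGiven {T : ℕ} {R : Type*} [MeasurableSpace R] (M : Mechanism T R)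
    (σ : Fin T → Strategy R) (θ : Fin T → AgentType) (s : Fin T → Signal) : ℝ :=
  ∫ r, M.acceptProb r ∂(Measure.pi fun t => (σ t (θ t) (s t) : Measure R))

/-- The number of agents of type `a` in the type profile `θ`. -/
def typeCount {T : ℕ} (θ : Fin T → AgentType) (a : AgentType) : ℕ :=
  (Finset.univ.filter fun t => θ t = a).card

namespace Setting

/-- With `T` agents, every fraction vector that can occur gives integer numbers of agents. -/
def Feasible (I : Setting) (T : ℕ) : Prop :=
  ∀ α ∈ I.typePrior.support, ∀ a, ∃ k : ℕ, α a * T = k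

/-- Probability of a type profile: the fractions are drawn from the prior, and then the types are
assigned uniformly at random among all profiles with these fractions. -/
def typeProfileProb (I : Setting) {T : ℕ} (θ : Fin T → AgentType) : ℝ :=
  (I.typePrior fun a => (typeCount θ a : ℝ) / T).toReal /
    (Finset.univ.filter fun θ' : Fin T → AgentType => typeCount θ' = typeCount θ).card

/-- Joint probability of a world and a signal profile: signals are independent given the world
(and both are independent of the types). -/
def worldSignalProb (I : Setting) {T : ℕ} (w : World) (s : Fin T → Signal) : ℝ :=
  I.worldProb w * ∏ t, I.signalProb w (s t)

/-- The majority wish: the alternative preferred by more than half of the agents in world `w`.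
No agent is ever indifferent, so for odd `T` it is `R` exactly if it is not `A`. -/
def majorityWish (I : Setting) {T : ℕ} (θ : Fin T → AgentType) (w : World) : Outcome :=
  if T < 2 * (Finset.univ.filter fun t =>
      I.value (θ t) w Outcome.R < I.value (θ t) w Outcome.A).card
  then Outcome.A else Outcome.R

/-- Probability that the mechanism outputs the majority wish. -/
def successProb (I : Setting) {T : ℕ} {R : Type*} [MeasurableSpace R] (M : Mechanism T R)
    (σ : Fin T → Strategy R) : ℝ :=
  ∑ θ : Fin T → AgentType, ∑ w : World, ∑ s : Fin T → Signal,
    I.typeProfileProb θ * I.worldSignalProb w s *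
      (if I.majorityWish θ w = Outcome.A then acceptGiven M σ θ s
        else 1 - acceptGiven M σ θ s)

/-- Probability that agent `t` is of type `a`. -/
def ownTypeProb (I : Setting) {T : ℕ} (t : Fin T) (a : AgentType) : ℝ :=
  ∑ θ ∈ Finset.univ.filter (fun θ : Fin T → AgentType => θ t = a), I.typeProfileProb θ

/-- Expected utility of agent `t` given that `t` is of type `a` (and before any signal is
received). If `t` has type `a` with probability zero, this is `0` for all strategy profiles. -/
def utility (I : Setting) {T : ℕ} {R : Type*} [MeasurableSpace R] (M : Mechanism T R)
    (σ : Fin T → Strategy R) (t : Fin T) (a : AgentType) : ℝ :=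
  (∑ θ ∈ Finset.univ.filter (fun θ : Fin T → AgentType => θ t = a),
    ∑ w : World, ∑ s : Fin T → Signal,
      I.typeProfileProb θ * I.worldSignalProb w s *
        (acceptGiven M σ θ s * I.value a w Outcome.A +
          (1 - acceptGiven M σ θ s) * I.value a w Outcome.R)) / I.ownTypeProb t a

/-- `ε`-strong Bayes Nash equilibrium. As agents know their own types, a coalition `D` is a set of
agents-with-types: `(t, a) ∈ D` means that agent `t`, when of type `a`, takes part in the deviation
(for example, all friendly agents deviate if `D` is the set of all `(t, F)`). -/
def IsStrongBNE (I : Setting) {T : ℕ} {R : Type*} [MeasurableSpace R] (M : Mechanism T R)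
    (ε : ℝ) (σ : Fin T → Strategy R) : Prop :=
  ¬ ∃ (D : Set (Fin T × AgentType)) (σ' : Fin T → Strategy R),
    (∀ t a, (t, a) ∉ D → σ t a = σ' t a) ∧
    (∀ t a, (t, a) ∈ D → I.utility M σ t a ≤ I.utility M σ' t a) ∧
    (∃ t a, (t, a) ∈ D ∧ I.utility M σ t a + ε < I.utility M σ' t a)

end Setting

end Voting

end

/-!
The fractions `(F, U, C)` are `(1/3, 0, 2/3)`, `(0, 0, 1)` or `(0, 1, 0)`, with equal probability, and
a signal is high with probability `1/4` in world `L` and `1/2` in world `H`. Let `T = 3m`, and suppose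
that a symmetric profile `σ` under an anonymous mechanism nearly always yields the majority wish.
Then, nearly always, `A` is output in world `H` if all agents are contingent, and `R` is output in
world `L` if the fractions are `(1/3, 0, 2/3)`.

Let all friendly agents deviate by reporting what `σ` prescribes to a contingent agent with a high
signal. By anonymity, in world `L` the mechanism then sees contingent agents of whom `m + Bin(2m, 1/4)`
have a high signal. In world `H` with contingent agents only, it sees `Bin(3m, 1/2)` high signals.
Both numbers have mean `3m/2`, and the first has the smaller variance; its law is in fact at most
`3/2` times the second, pointwise (`coeff_shifted_le`, proved for odd `m`). So an
event that is unlikely under the second law is unlikely under the first, and `A` is now output in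
world `L` with probability close to `1` (`one_sub_acceptIn_mimicHigh_le`). In world `H` the deviation
may have bad consequences, but this world has prior probability `1/10` only, which makes the deviation
profitable for friendly agents (`utility_mimicHigh_gt`). They know that they are in this case, as
friendly agents occur for only one vector of fractions.
-/

open MeasureTheory

noncomputable section

namespace Voting

/-! ### A pointwise comparison of two binomial laws -/

open Nat in
/-- The bound of `choose_ratio_le` at `j = i`, where the quotient of its two sides is largest. As a
function of `i`, this quotient is decreasing. -/
theorem factorial_ratio_le (i : ℕ) :
    2 * 9 ^ (2 * i + 1) * (2 * (2 * i + 1))! * (3 * i + 1)! ≤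
      3 * 2 ^ (2 * i + 1) * 3 ^ i * i ! * (3 * (2 * i + 1))! := by
  induction i with
  | zero => decide
  | succ i ih =>
    have e1 : (2 * (2 * (i + 1) + 1))! =
        (4 * i + 6) * (4 * i + 5) * (4 * i + 4) * (4 * i + 3) * (2 * (2 * i + 1))! := by
      rw [show 2 * (2 * (i + 1) + 1) = 2 * (2 * i + 1) + 1 + 1 + 1 + 1 by ring]
      simp only [Nat.factorial_succ]; ring
    have e2 : (3 * (i + 1) + 1)! =
        (3 * i + 4) * (3 * i + 3) * (3 * i + 2) * (3 * i + 1)! := by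
      rw [show 3 * (i + 1) + 1 = 3 * i + 1 + 1 + 1 + 1 by ring]
      simp only [Nat.factorial_succ]; ring
    have e3 : (3 * (2 * (i + 1) + 1))! =
        (6 * i + 9) * (6 * i + 8) * (6 * i + 7) * (6 * i + 6) * (6 * i + 5) * (6 * i + 4) *
          (3 * (2 * i + 1))! := by
      rw [show 3 * (2 * (i + 1) + 1) = 3 * (2 * i + 1) + 1 + 1 + 1 + 1 + 1 + 1 by ring]
      simp only [Nat.factorial_succ]; ring
    have key : 9 * ((4 * i + 5) * (4 * i + 3)) ≤ 4 * ((6 * i + 7) * (6 * i + 5)) := by nlinarith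
    rw [e1, e2, e3, Nat.factorial_succ i, show 2 * (i + 1) + 1 = 2 * i + 1 + 2 by ring,
      pow_add 9, pow_add 2, pow_succ 3]
    -- after cancelling the common factors, the quotient of consecutive terms is that of `key`
    have h := Nat.mul_le_mul ih (Nat.mul_le_mul_left
      (216 * ((2 * i + 3) * (i + 1) * (i + 1) * (3 * i + 4) * (3 * i + 2))) key)
    generalize (2 * (2 * i + 1))! = a, (3 * i + 1)! = b, (3 * (2 * i + 1))! = c, i ! = d,
      9 ^ (2 * i + 1) = x, 2 ^ (2 * i + 1) = y, 3 ^ i = z at h ⊢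
    calc _ = _ := by ring
      _ ≤ _ := h
      _ = _ := by ring

open Nat in
/-- Up to a constant, the quotient of `3 ^ (-j) * (2 * (2 * i + 1)).choose j` by
`(3 * (2 * i + 1)).choose (2 * i + 1 + j)` is `(2 * i + 1 + j)! / (3 ^ j * j !)`. It increases in `j`
up to `j = i`, and decreases from there. -/
theorem factorial_mul_le_of_central (i j : ℕ) :
    (2 * i + 1 + j)! * (3 ^ i * i !) ≤ (3 * i + 1)! * (3 ^ j * j !) := by
  rcases le_total i j with h | h
  · induction j, h using Nat.le_induction with
    | base => rw [show 2 * i + 1 + i = 3 * i + 1 by ring]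
    | succ j hj ih =>
      rw [← add_assoc, Nat.factorial_succ (2 * i + 1 + j), Nat.factorial_succ j, pow_succ 3 j]
      calc _ = (2 * i + 1 + j + 1) * ((2 * i + 1 + j)! * (3 ^ i * i !)) := by ring
        _ ≤ (3 * (j + 1)) * ((3 * i + 1)! * (3 ^ j * j !)) := Nat.mul_le_mul (by omega) ih
        _ = _ := by ring
  · induction h using Nat.decreasingInduction with
    | self => rw [show 2 * i + 1 + i = 3 * i + 1 by ring]
    | of_succ j hj ih =>
      rw [← add_assoc, Nat.factorial_succ (2 * i + 1 + j), Nat.factorial_succ j, pow_succ 3 j] at ih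
      refine Nat.le_of_mul_le_mul_left (c := 2 * i + 1 + j + 1) ?_ (by omega)
      calc _ = (2 * i + 1 + j + 1) * (2 * i + 1 + j)! * (3 ^ i * i !) := by ring
        _ ≤ (3 * (j + 1)) * ((3 * i + 1)! * (3 ^ j * j !)) := ih.trans_eq (by ring)
        _ ≤ (2 * i + 1 + j + 1) * ((3 * i + 1)! * (3 ^ j * j !)) :=
          Nat.mul_le_mul_right _ (by omega)

open Nat in
theorem choose_ratio_le (i j : ℕ) (hj : j ≤ 2 * (2 * i + 1)) :
    2 * 3 ^ (2 * (2 * i + 1) - j) * (2 * (2 * i + 1)).choose j ≤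
      3 * 2 ^ (2 * i + 1) * (3 * (2 * i + 1)).choose (2 * i + 1 + j) := by
  have h1 := factorial_ratio_le i
  have h2 := factorial_mul_le_of_central i j
  have c1 := Nat.choose_mul_factorial_mul_factorial hj
  have c2 := Nat.choose_mul_factorial_mul_factorial
    (show 2 * i + 1 + j ≤ 3 * (2 * i + 1) by omega)
  rw [show 3 * (2 * i + 1) - (2 * i + 1 + j) = 2 * (2 * i + 1) - j by omega] at c2
  have hp : 9 ^ (2 * i + 1) = 3 ^ (2 * (2 * i + 1) - j) * 3 ^ j := by
    rw [← pow_add, Nat.sub_add_cancel hj, pow_mul]; rfl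
  rw [← c1, ← c2, hp] at h1
  refine Nat.le_of_mul_le_mul_left (c := j ! * (2 * (2 * i + 1) - j)! * (2 * i + 1 + j)! *
    (3 ^ j * (3 ^ i * i !) * (3 * i + 1)!)) ?_
    (by positivity)
  have h := Nat.mul_le_mul h1 h2
  generalize (2 * (2 * i + 1) - j)! = a, (3 * i + 1)! = b, (2 * i + 1 + j)! = c, i ! = d,
    j ! = e, (2 * (2 * i + 1)).choose j = u, (3 * (2 * i + 1)).choose (2 * i + 1 + j) = v,
    3 ^ (2 * (2 * i + 1) - j) = w, 2 ^ (2 * i + 1) = y, 3 ^ i = z, 3 ^ j = x at h ⊢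
  calc _ = _ := by ring
    _ ≤ _ := h
    _ = _ := by ring

open Polynomial in
/-- The law of `m + Bin(2m, 1/4)` is at most `3 / 2` times the law of `Bin(3m, 1/2)`, pointwise, as
a statement about generating polynomials. -/
theorem coeff_shifted_le (m : ℕ) (hm : Odd m) (k : ℕ) :
    (X ^ m * (C (1 / 4 : ℝ) * X + C (3 / 4)) ^ (2 * m)).coeff k ≤
      3 / 2 * ((C (1 / 2 : ℝ) * X + C (1 / 2)) ^ (3 * m)).coeff k := by
  have e1 : (C (1 / 4 : ℝ) * X + C (3 / 4)) ^ (2 * m) =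
      C ((1 / 4) ^ (2 * m)) * (X + C 3) ^ (2 * m) := by
    rw [C_pow, ← mul_pow, mul_add, ← C_mul]; norm_num
  have e2 : (C (1 / 2 : ℝ) * X + C (1 / 2)) ^ (3 * m) =
      C ((1 / 2) ^ (3 * m)) * (X + 1) ^ (3 * m) := by
    rw [C_pow, ← mul_pow, mul_add, mul_one]
  rw [e1, e2, coeff_X_pow_mul', coeff_C_mul, coeff_C_mul, coeff_X_add_C_pow, coeff_X_add_one_pow]
  split_ifs with hk
  swap; · positivity
  obtain ⟨j, rfl⟩ := Nat.exists_eq_add_of_le hk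
  rw [Nat.add_sub_cancel_left]
  rcases lt_or_ge (2 * m) j with hj | hj
  · rw [Nat.choose_eq_zero_of_lt hj]; simp only [Nat.cast_zero, mul_zero]; positivity
  obtain ⟨i, rfl⟩ := hm
  have h := choose_ratio_le i j hj
  have h' : (2 * 3 ^ (2 * (2 * i + 1) - j) * ((2 * (2 * i + 1)).choose j : ℝ)) ≤
      3 * 2 ^ (2 * i + 1) * ((3 * (2 * i + 1)).choose (2 * i + 1 + j) : ℝ) := by exact_mod_cast h
  have e4 : (1 / 2 : ℝ) ^ (3 * (2 * i + 1)) = (1 / 4) ^ (2 * (2 * i + 1)) * 2 ^ (2 * i + 1) := by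
    rw [pow_mul, pow_mul, ← mul_pow]; norm_num
  rw [e4]
  have h4 : (0 : ℝ) < (1 / 4) ^ (2 * (2 * i + 1)) := by positivity
  nlinarith [mul_le_mul_of_nonneg_left h' h4.le]

/-! ### Expectations of functions of the number of high signals -/

open Polynomial in
/-- The linear functional on polynomials that sends `X ^ n` to `φ n`: applied to the generating
polynomial of a random variable `N`, it gives the expectation of `φ N`. -/
def evalCoeffs (φ : ℕ → ℝ) : ℝ[X] →ₗ[ℝ] ℝ :=
  Polynomial.lsum fun n => φ n • LinearMap.id

open Polynomial in
theorem evalCoeffs_C_mul_X_pow (φ : ℕ → ℝ) (c : ℝ) (n : ℕ) :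
    evalCoeffs φ (C c * X ^ n) = c * φ n := by
  rw [evalCoeffs, Polynomial.lsum_apply, C_mul_X_pow_eq_monomial, sum_monomial_index _ _ (by simp)]
  simp [mul_comm]

open Polynomial in
theorem evalCoeffs_le {φ : ℕ → ℝ} (hφ : ∀ n, 0 ≤ φ n) {p q : ℝ[X]} {c : ℝ}
    (h : ∀ n, p.coeff n ≤ c * q.coeff n) : evalCoeffs φ p ≤ c * evalCoeffs φ q := by
  rw [evalCoeffs, Polynomial.lsum_apply, Polynomial.lsum_apply,
    Polynomial.sum_over_range' p (by simp) (max p.natDegree q.natDegree + 1) (by omega),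
    Polynomial.sum_over_range' q (by simp) (max p.natDegree q.natDegree + 1) (by omega),
    Finset.mul_sum]
  refine Finset.sum_le_sum fun n _ => ?_
  simp only [LinearMap.smul_apply, LinearMap.id_apply, smul_eq_mul]
  nlinarith [mul_le_mul_of_nonneg_left (h n) (hφ n)]

open Polynomial in
/-- The expectation of a function of a sum of independent variables, from the product of their
generating polynomials. -/
theorem sum_prod_mul_apply_sum {ι κ : Type*} [Fintype ι] [DecidableEq ι] [Fintype κ]
    (p : κ → ℝ) (k : ι → κ → ℕ) (φ : ℕ → ℝ) :
    ∑ s : ι → κ, (∏ t, p (s t)) * φ (∑ t, k t (s t)) =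
      evalCoeffs φ (∏ t, ∑ a, C (p a) * X ^ k t a) := by
  rw [Fintype.prod_sum, map_sum]
  refine Finset.sum_congr rfl fun s _ => ?_
  rw [Finset.prod_mul_distrib, ← map_prod, Finset.prod_pow_eq_pow_sum, evalCoeffs_C_mul_X_pow]

theorem sum_signal {M : Type*} [AddCommMonoid M] (f : Signal → M) :
    ∑ m, f m = f Signal.lo + f Signal.hi := by
  change ∑ m ∈ {Signal.lo, Signal.hi}, f m = _
  rw [Finset.sum_pair (by decide)]

theorem sum_world {M : Type*} [AddCommMonoid M] (f : World → M) :
    ∑ w, f w = f World.L + f World.H := by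
  change ∑ m ∈ {World.L, World.H}, f m = _
  rw [Finset.sum_pair (by decide)]

/-- The number of high signals in a signal profile. -/
def highCount {T : ℕ} (s : Fin T → Signal) : ℕ :=
  (Finset.univ.filter fun t => s t = Signal.hi).card

open Polynomial in
/-- Compare two experiments with `3 * m` agents: signals are high with probability `1 / 4`, and then
the signals of `m` of the agents are replaced by high ones; or signals are high with probability
`1 / 2`. Any nonnegative function of the number of high signals has an expectation in the first that
is at most `3 / 2` times that in the second. -/
theorem sum_raise_le {m : ℕ} (hm : Odd m) (P : Fin (3 * m) → Prop) [DecidablePred P]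
    (hP : (Finset.univ.filter P).card = m) {p q : Signal → ℝ}
    (plo : p Signal.lo = 3 / 4) (phi : p Signal.hi = 1 / 4)
    (qlo : q Signal.lo = 1 / 2) (qhi : q Signal.hi = 1 / 2)
    {φ : ℕ → ℝ} (hφ : ∀ n, 0 ≤ φ n) :
    ∑ s : Fin (3 * m) → Signal,
        (∏ t, p (s t)) * φ (highCount fun t => if P t then Signal.hi else s t) ≤
      3 / 2 * ∑ s : Fin (3 * m) → Signal, (∏ t, q (s t)) * φ (highCount s) := by
  have e1 : ∀ s : Fin (3 * m) → Signal,
      (highCount fun t => if P t then Signal.hi else s t) =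
        ∑ t, (if (if P t then Signal.hi else s t) = Signal.hi then 1 else 0) := fun s => by
    rw [highCount, Finset.card_filter]
  have e2 : ∀ s : Fin (3 * m) → Signal,
      highCount s = ∑ t, (if s t = Signal.hi then 1 else 0) := fun s => by
    rw [highCount, Finset.card_filter]
  simp only [e1, e2]
  rw [sum_prod_mul_apply_sum p
      (fun t a => if (if P t then Signal.hi else a) = Signal.hi then 1 else 0) φ,
    sum_prod_mul_apply_sum q (fun _ a => if a = Signal.hi then 1 else 0) φ]
  have f1 : ∀ t, ∑ a, C (p a) * (X : ℝ[X]) ^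
      (if (if P t then Signal.hi else a) = Signal.hi then 1 else 0) =
        if P t then X else C (1 / 4) * X + C (3 / 4) := fun t => by
    rw [sum_signal, plo, phi]
    by_cases h : P t
    · simp only [h, if_true, pow_one]
      rw [← add_mul, ← C_add]; norm_num
    · simp [h, add_comm]
  have f2 : ∑ a, C (q a) * (X : ℝ[X]) ^ (if a = Signal.hi then 1 else 0) =
        C (1 / 2) * X + C (1 / 2) := by
    rw [sum_signal, qlo, qhi]; simp [add_comm]
  have hP' : (Finset.univ.filter fun t => ¬ P t).card = 2 * m := by
    have := Finset.card_filter_add_card_filter_not (s := Finset.univ) P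
    rw [Finset.card_univ, Fintype.card_fin] at this; omega
  simp only [f1, f2]
  rw [Finset.prod_ite, Finset.prod_const, Finset.prod_const, Finset.prod_const, hP, hP',
    Finset.card_univ, Fintype.card_fin]
  exact evalCoeffs_le hφ (coeff_shifted_le m hm)

/-! ### Anonymity -/

variable {T : ℕ} {R : Type*} [MeasurableSpace R]

theorem exists_perm_of_card_eq {ι γ : Type*} [Fintype ι] [DecidableEq γ] {f g : ι → γ}
    (h : ∀ c, (Finset.univ.filter fun t => f t = c).card =
      (Finset.univ.filter fun t => g t = c).card) :
    ∃ π : Equiv.Perm ι, ∀ t, g (π t) = f t := by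
  have e : ∀ c, Nonempty ({t // f t = c} ≃ {t // g t = c}) := fun c => by
    rw [← Fintype.card_eq, Fintype.card_subtype, Fintype.card_subtype]; exact h c
  exact ⟨Equiv.ofFiberEquiv fun c => (e c).some, Equiv.ofFiberEquiv_map _⟩

theorem exists_perm_of_highCount_eq {T : ℕ} {s s' : Fin T → Signal}
    (h : highCount s = highCount s') : ∃ π : Equiv.Perm (Fin T), ∀ t, s' (π t) = s t := by
  refine exists_perm_of_card_eq fun c => ?_
  have key : ∀ s : Fin T → Signal,
      (Finset.univ.filter fun t => s t = Signal.lo).card + highCount s = T := fun s => by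
    have := Finset.card_filter_add_card_filter_not (s := Finset.univ) fun t => s t = Signal.lo
    rw [Finset.card_univ, Fintype.card_fin] at this
    refine Eq.trans ?_ this
    rw [highCount]; congr 3; ext t; cases s t <;> simp
  cases c
  · have := key s; have := key s'; omega
  · exact h

theorem acceptGiven_nonneg (M : Mechanism T R) (σ : Fin T → Strategy R) (θ : Fin T → AgentType)
    (s : Fin T → Signal) : 0 ≤ acceptGiven M σ θ s :=
  integral_nonneg fun r => (M.acceptProb_mem r).1

theorem acceptGiven_le_one (M : Mechanism T R) (σ : Fin T → Strategy R) (θ : Fin T → AgentType)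
    (s : Fin T → Signal) : acceptGiven M σ θ s ≤ 1 := by
  have h := norm_integral_le_of_norm_le_const
    (μ := Measure.pi fun t => (σ t (θ t) (s t) : Measure R)) (f := M.acceptProb) (C := 1)
    (Filter.Eventually.of_forall fun r => by
      rw [Real.norm_of_nonneg (M.acceptProb_mem r).1]; exact (M.acceptProb_mem r).2)
  rw [probReal_univ, mul_one] at h
  exact (le_abs_self _).trans h

theorem acceptGiven_comp_perm {M : Mechanism T R} (hM : M.Anonymous) {σ : Fin T → Strategy R}
    (hσ : IsSymmetric σ) (θ : Fin T → AgentType) (s : Fin T → Signal)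
    (π : Equiv.Perm (Fin T)) :
    acceptGiven M σ (fun t => θ (π t)) (fun t => s (π t)) = acceptGiven M σ θ s := by
  have h := (measurePreserving_piCongrLeft
    (fun t => (σ t (θ t) (s t) : Measure R)) π).integral_comp' M.acceptProb
  rw [acceptGiven, acceptGiven, ← h]
  have hm : (fun t => (σ t (θ (π t)) (s (π t)) : Measure R)) =
      fun t => (σ (π t) (θ (π t)) (s (π t)) : Measure R) := by
    funext t; rw [hσ t (π t)]
  rw [hm]
  refine integral_congr_ae (Filter.Eventually.of_forall fun r => ?_)
  have hr : ∀ t, MeasurableEquiv.piCongrLeft (fun _ => R) π r (π t) = r t := fun t => by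
    rw [MeasurableEquiv.coe_piCongrLeft, Equiv.piCongrLeft_apply_apply]
  change M.acceptProb r = M.acceptProb (MeasurableEquiv.piCongrLeft (fun _ => R) π r)
  rw [← hM π (MeasurableEquiv.piCongrLeft (fun _ => R) π r)]
  simp only [hr]

theorem exists_perm_of_typeCount_eq {θ θ' : Fin T → AgentType}
    (h : typeCount θ = typeCount θ') : ∃ π : Equiv.Perm (Fin T), ∀ t, θ' (π t) = θ t :=
  exists_perm_of_card_eq fun c => congrFun h c

/-! ### Success probability and utilities -/

namespace Setting

variable (I : Setting)

/-- The probability that `A` is output in world `w` when the type profile is `θ`. -/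
def acceptIn (M : Mechanism T R) (σ : Fin T → Strategy R) (θ : Fin T → AgentType) (w : World) :
    ℝ :=
  ∑ s : Fin T → Signal, (∏ t, I.signalProb w (s t)) * acceptGiven M σ θ s

/-- The probability that the alternative output in world `w` is not the majority wish when the
type profile is `θ`. -/
def failIn (M : Mechanism T R) (σ : Fin T → Strategy R) (θ : Fin T → AgentType) (w : World) : ℝ :=
  if I.majorityWish θ w = Outcome.A then 1 - I.acceptIn M σ θ w else I.acceptIn M σ θ w

theorem sum_prod_signalProb (w : World) :
    ∑ s : Fin T → Signal, ∏ t, I.signalProb w (s t) = 1 := by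
  rw [← Fintype.prod_sum fun _ : Fin T => I.signalProb w]
  simp [I.signalProb_sum]

theorem one_sub_acceptIn (M : Mechanism T R) (σ : Fin T → Strategy R) (θ : Fin T → AgentType)
    (w : World) : 1 - I.acceptIn M σ θ w =
      ∑ s : Fin T → Signal, (∏ t, I.signalProb w (s t)) * (1 - acceptGiven M σ θ s) := by
  simp only [mul_sub, mul_one, Finset.sum_sub_distrib, sum_prod_signalProb, acceptIn]

theorem acceptIn_nonneg (M : Mechanism T R) (σ : Fin T → Strategy R) (θ : Fin T → AgentType)
    (w : World) : 0 ≤ I.acceptIn M σ θ w :=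
  Finset.sum_nonneg fun _ _ => mul_nonneg
    (Finset.prod_nonneg fun _ _ => I.signalProb_nonneg _ _) (acceptGiven_nonneg M σ θ _)

theorem acceptIn_le_one (M : Mechanism T R) (σ : Fin T → Strategy R) (θ : Fin T → AgentType)
    (w : World) : I.acceptIn M σ θ w ≤ 1 := by
  rw [← sub_nonneg, one_sub_acceptIn]
  exact Finset.sum_nonneg fun _ _ => mul_nonneg
    (Finset.prod_nonneg fun _ _ => I.signalProb_nonneg _ _)
    (sub_nonneg.2 (acceptGiven_le_one M σ θ _))

theorem failIn_nonneg (M : Mechanism T R) (σ : Fin T → Strategy R) (θ : Fin T → AgentType)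
    (w : World) : 0 ≤ I.failIn M σ θ w := by
  unfold failIn
  split_ifs
  · exact sub_nonneg.2 (I.acceptIn_le_one M σ θ w)
  · exact I.acceptIn_nonneg M σ θ w

theorem acceptIn_eq_of_typeCount_eq {M : Mechanism T R} (hM : M.Anonymous)
    {σ : Fin T → Strategy R} (hσ : IsSymmetric σ) {θ θ' : Fin T → AgentType}
    (h : typeCount θ = typeCount θ') (w : World) :
    I.acceptIn M σ θ w = I.acceptIn M σ θ' w := by
  obtain ⟨π, hπ⟩ := exists_perm_of_typeCount_eq h
  obtain rfl : (fun t => θ' (π t)) = θ := funext hπ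
  unfold acceptIn
  refine (Fintype.sum_equiv (Equiv.arrowCongr π.symm (Equiv.refl Signal)) _ _ fun s => ?_).symm
  have e : (Equiv.arrowCongr π.symm (Equiv.refl Signal)) s = fun t => s (π t) := by
    funext t; simp
  rw [e, acceptGiven_comp_perm hM hσ, Equiv.prod_comp π fun t => I.signalProb w (s t)]

theorem majorityWish_eq_of_typeCount_eq {θ θ' : Fin T → AgentType}
    (h : typeCount θ = typeCount θ') (w : World) :
    I.majorityWish θ w = I.majorityWish θ' w := by
  obtain ⟨π, hπ⟩ := exists_perm_of_typeCount_eq h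
  obtain rfl : (fun t => θ' (π t)) = θ := funext hπ
  have e : (Finset.univ.filter fun t =>
      I.value (θ' (π t)) w Outcome.R < I.value (θ' (π t)) w Outcome.A).card =
      (Finset.univ.filter fun t =>
        I.value (θ' t) w Outcome.R < I.value (θ' t) w Outcome.A).card :=
    Finset.card_equiv π (by simp)
  unfold majorityWish
  rw [e]

theorem typeProfileProb_nonneg (θ : Fin T → AgentType) : 0 ≤ I.typeProfileProb θ := by
  unfold typeProfileProb; positivity

theorem sum_typeProfileProb_of_typeCount_eq (θ₀ : Fin T → AgentType) :
    ∑ θ ∈ Finset.univ.filter (fun θ : Fin T → AgentType => typeCount θ = typeCount θ₀),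
      I.typeProfileProb θ = (I.typePrior fun a => (typeCount θ₀ a : ℝ) / T).toReal := by
  have h : ∀ θ ∈ Finset.univ.filter (fun θ : Fin T → AgentType => typeCount θ = typeCount θ₀),
      I.typeProfileProb θ = I.typeProfileProb θ₀ := fun θ hθ => by
    unfold typeProfileProb; rw [(Finset.mem_filter.1 hθ).2]
  rw [Finset.sum_congr rfl h, Finset.sum_const, nsmul_eq_mul, typeProfileProb,
    mul_div_cancel₀]
  have : θ₀ ∈ Finset.univ.filter (fun θ : Fin T → AgentType => typeCount θ = typeCount θ₀) := by
    simp
  exact_mod_cast (Finset.card_pos.2 ⟨_, this⟩).ne'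

theorem sum_typeProfileProb_le_one (hT : T ≠ 0) :
    ∑ θ : Fin T → AgentType, I.typeProfileProb θ ≤ 1 := by
  classical
  have hinj : Function.Injective fun (c : AgentType → ℕ) (a : AgentType) => (c a : ℝ) / T := by
    intro c c' h
    funext a
    have := congrFun h a
    have hT' : (T : ℝ) ≠ 0 := by exact_mod_cast hT
    field_simp at this
    exact_mod_cast this
  rw [← Finset.sum_fiberwise_of_maps_to (g := fun θ : Fin T → AgentType => typeCount θ)
    (t := Finset.univ.image fun θ : Fin T → AgentType => typeCount θ)
    (fun θ hθ => Finset.mem_image_of_mem _ hθ)]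
  have h : ∀ c ∈ Finset.univ.image (fun θ : Fin T → AgentType => typeCount θ),
      ∑ θ ∈ Finset.univ.filter (fun θ : Fin T → AgentType => typeCount θ = c),
        I.typeProfileProb θ = (I.typePrior fun a => (c a : ℝ) / T).toReal := fun c hc => by
    obtain ⟨θ₀, -, rfl⟩ := Finset.mem_image.1 hc
    exact I.sum_typeProfileProb_of_typeCount_eq θ₀
  rw [Finset.sum_congr rfl h, ← ENNReal.toReal_sum fun _ _ => I.typePrior.apply_ne_top _]
  refine ENNReal.toReal_le_of_le_ofReal zero_le_one ?_
  rw [ENNReal.ofReal_one, ← I.typePrior.tsum_coe]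
  exact (ENNReal.sum_le_tsum _).trans (ENNReal.tsum_comp_le_tsum_of_injective hinj _)

/-- The total mass of the type profiles is `1` for feasible `T`; without feasibility it may be less. -/
theorem successProb_eq (M : Mechanism T R) (σ : Fin T → Strategy R) :
    I.successProb M σ =
      ∑ θ : Fin T → AgentType, I.typeProfileProb θ -
        ∑ θ : Fin T → AgentType, ∑ w, I.typeProfileProb θ * I.worldProb w * I.failIn M σ θ w := by
  rw [successProb, ← Finset.sum_sub_distrib]
  refine Finset.sum_congr rfl fun θ _ => ?_
  have h : ∀ w, ∑ s : Fin T → Signal, I.typeProfileProb θ * I.worldSignalProb w s *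
      (if I.majorityWish θ w = Outcome.A then acceptGiven M σ θ s
        else 1 - acceptGiven M σ θ s) =
      I.typeProfileProb θ * I.worldProb w * (1 - I.failIn M σ θ w) := fun w => by
    unfold failIn worldSignalProb
    split_ifs
    · rw [sub_sub_cancel, acceptIn, Finset.mul_sum]
      exact Finset.sum_congr rfl fun s _ => by ring
    · rw [one_sub_acceptIn, Finset.mul_sum]
      exact Finset.sum_congr rfl fun s _ => by ring
  simp only [h, mul_sub, mul_one, Finset.sum_sub_distrib]
  rw [← Finset.mul_sum, I.worldProb_sum, mul_one]

/-- A mechanism that rarely fails overall rarely fails in any given world with any given numbers of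
agents of each type that are not too unlikely. -/
theorem prior_mul_failIn_le (hT : T ≠ 0) {M : Mechanism T R} (hM : M.Anonymous)
    {σ : Fin T → Strategy R} (hσ : IsSymmetric σ) (θ₀ : Fin T → AgentType) (w : World) :
    (I.typePrior fun a => (typeCount θ₀ a : ℝ) / T).toReal * (I.worldProb w * I.failIn M σ θ₀ w) ≤
      1 - I.successProb M σ := by
  have h1 := I.sum_typeProfileProb_le_one hT
  rw [successProb_eq, ← sum_typeProfileProb_of_typeCount_eq, Finset.sum_mul]
  have hnn : ∀ θ : Fin T → AgentType, ∀ w,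
      0 ≤ I.typeProfileProb θ * I.worldProb w * I.failIn M σ θ w := fun θ w =>
    mul_nonneg (mul_nonneg (I.typeProfileProb_nonneg θ) (I.worldProb_pos w).le)
      (I.failIn_nonneg M σ θ w)
  have h2 : ∑ θ ∈ Finset.univ.filter
      (fun θ : Fin T → AgentType => typeCount θ = typeCount θ₀),
        I.typeProfileProb θ * (I.worldProb w * I.failIn M σ θ₀ w) ≤
      ∑ θ : Fin T → AgentType, ∑ w, I.typeProfileProb θ * I.worldProb w * I.failIn M σ θ w :=
    calc _ ≤ ∑ θ ∈ Finset.univ.filter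
          (fun θ : Fin T → AgentType => typeCount θ = typeCount θ₀),
            ∑ w, I.typeProfileProb θ * I.worldProb w * I.failIn M σ θ w := by
          refine Finset.sum_le_sum fun θ hθ => ?_
          have hθ' := (Finset.mem_filter.1 hθ).2
          refine le_trans (le_of_eq ?_)
            (Finset.single_le_sum (fun w _ => hnn θ w) (Finset.mem_univ w))
          rw [failIn, failIn, I.majorityWish_eq_of_typeCount_eq hθ',
            I.acceptIn_eq_of_typeCount_eq hM hσ hθ', mul_assoc]
      _ ≤ _ := Finset.sum_le_sum_of_subset_of_nonneg (Finset.filter_subset _ _)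
          fun θ _ _ => Finset.sum_nonneg fun w _ => hnn θ w
  linarith

/-- An agent who can infer the numbers of agents of each type from his own type may take any type
profile `θ₀` with these numbers for the actual one, by anonymity and symmetry. -/
theorem utility_eq {M : Mechanism T R} (hM : M.Anonymous)
    {σ : Fin T → Strategy R} (hσ : IsSymmetric σ) {t : Fin T} {a : AgentType}
    (hta : I.ownTypeProb t a ≠ 0) {θ₀ : Fin T → AgentType}
    (h : ∀ θ : Fin T → AgentType, θ t = a → I.typeProfileProb θ ≠ 0 →
      typeCount θ = typeCount θ₀) :
    I.utility M σ t a = ∑ w, I.worldProb w * (I.acceptIn M σ θ₀ w * I.value a w Outcome.A +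
      (1 - I.acceptIn M σ θ₀ w) * I.value a w Outcome.R) := by
  rw [utility, div_eq_iff hta, ownTypeProb, Finset.mul_sum]
  refine Finset.sum_congr rfl fun θ hθ => ?_
  by_cases h0 : I.typeProfileProb θ = 0
  · simp [h0]
  have hθ' := h θ (Finset.mem_filter.1 hθ).2 h0
  rw [Finset.sum_mul]
  refine Finset.sum_congr rfl fun w _ => ?_
  rw [← I.acceptIn_eq_of_typeCount_eq hM hσ hθ', one_sub_acceptIn, acceptIn, Finset.sum_mul,
    Finset.sum_mul, ← Finset.sum_add_distrib, Finset.mul_sum, Finset.sum_mul]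
  refine Finset.sum_congr rfl fun s _ => ?_
  rw [worldSignalProb]; ring

end Setting

/-! ### The setting -/

/-- The vector of fractions `f`, `u`, `c` of friendly, unfriendly and contingent agents. -/
def fractions (f u c : ℝ) : AgentType → ℝ
  | AgentType.F => f
  | AgentType.U => u
  | AgentType.C => c

theorem fractions_mem_stdSimplex {f u c : ℝ} (hf : 0 ≤ f) (hu : 0 ≤ u) (hc : 0 ≤ c)
    (h : f + u + c = 1) : fractions f u c ∈ stdSimplex ℝ AgentType := by
  refine ⟨fun a => by cases a <;> assumption, ?_⟩
  change ∑ a ∈ {AgentType.F, AgentType.U, AgentType.C}, fractions f u c a = 1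
  rw [Finset.sum_insert (by decide), Finset.sum_pair (by decide), ← add_assoc]
  exact h

open Classical in
/-- The support of the prior over type distributions. -/
def fractionVectors : Finset (AgentType → ℝ) :=
  {fractions (1 / 3) 0 (2 / 3), fractions 0 0 1, fractions 0 1 0}

theorem fractionVectors_nonempty : fractionVectors.Nonempty :=
  ⟨_, Finset.mem_insert_self _ _⟩

/-- The setting in which world `L` with the first vector of fractions can be made to look like world
`H` with the second. World `L` is likely enough that friendly agents, who gain `1` if `A` replaces
`R` in world `L`, accept the risk of losing `3` in world `H`, where a deviation that imitates high
signals could be detected. The third vector makes unfriendly agents possible; they take no part in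
the argument, as there are no friendly agents then. -/
def confusingSetting : Setting where
  worldProb
    | World.L => 9 / 10
    | World.H => 1 / 10
  worldProb_pos w := by cases w <;> norm_num
  worldProb_sum := by rw [sum_world]; norm_num
  signalProb
    | World.L, Signal.lo => 3 / 4
    | World.L, Signal.hi => 1 / 4
    | World.H, Signal.lo => 1 / 2
    | World.H, Signal.hi => 1 / 2
  signalProb_nonneg w m := by cases w <;> cases m <;> norm_num
  signalProb_sum w := by rw [sum_signal]; cases w <;> norm_num
  corr_lo := by norm_num
  corr_hi := by norm_num
  value
    | AgentType.F, World.L, Outcome.A => 2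
    | AgentType.F, World.L, Outcome.R => 1
    | AgentType.F, World.H, Outcome.A => 3
    | AgentType.F, World.H, Outcome.R => 0
    | AgentType.U, World.L, Outcome.A => 0
    | AgentType.U, World.L, Outcome.R => 3
    | AgentType.U, World.H, Outcome.A => 1
    | AgentType.U, World.H, Outcome.R => 2
    | AgentType.C, World.L, Outcome.A => 0
    | AgentType.C, World.L, Outcome.R => 1
    | AgentType.C, World.H, Outcome.A => 1
    | AgentType.C, World.H, Outcome.R => 0
  value_A a := by cases a <;> decide
  value_R a := by cases a <;> decide
  friendly := by decide
  unfriendly := by decide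
  contingent_L := by decide
  contingent_H := by decide
  typePrior := PMF.uniformOfFinset fractionVectors fractionVectors_nonempty
  typePrior_mem α hα := by
    classical
    rw [PMF.mem_support_uniformOfFinset_iff, fractionVectors] at hα
    simp only [Finset.mem_insert, Finset.mem_singleton] at hα
    rcases hα with rfl | rfl | rfl <;> exact fractions_mem_stdSimplex
      (by norm_num) (by norm_num) (by norm_num) (by norm_num)

theorem mem_support_confusingSetting_iff {α : AgentType → ℝ} :
    α ∈ confusingSetting.typePrior.support ↔
      α = fractions (1 / 3) 0 (2 / 3) ∨ α = fractions 0 0 1 ∨ α = fractions 0 1 0 := by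
  classical
  rw [confusingSetting, PMF.mem_support_uniformOfFinset_iff, fractionVectors]
  simp only [Finset.mem_insert, Finset.mem_singleton]

theorem one_third_le_typePrior {α : AgentType → ℝ}
    (hα : α ∈ confusingSetting.typePrior.support) :
    1 / 3 ≤ (confusingSetting.typePrior α).toReal := by
  classical
  rw [confusingSetting, PMF.mem_support_uniformOfFinset_iff] at hα
  rw [confusingSetting, PMF.uniformOfFinset_apply, if_pos hα, ENNReal.toReal_inv,
    ENNReal.toReal_natCast, one_div]
  have h3 : fractionVectors.card ≤ 3 := Finset.card_le_three
  have h0 : 0 < fractionVectors.card := Finset.card_pos.2 fractionVectors_nonempty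
  exact inv_anti₀ (by exact_mod_cast h0) (by exact_mod_cast h3)

theorem confusingSetting_feasible_iff {T : ℕ} : confusingSetting.Feasible T ↔ 3 ∣ T := by
  constructor
  · intro h
    obtain ⟨k, hk⟩ := h _ (mem_support_confusingSetting_iff.2 (Or.inl rfl)) AgentType.F
    refine ⟨k, ?_⟩
    have hk' : (1 / 3 : ℝ) * T = k := hk
    have : (T : ℝ) = 3 * k := by linarith
    exact_mod_cast this
  · rintro ⟨k, rfl⟩ α hα a
    rcases mem_support_confusingSetting_iff.1 hα with rfl | rfl | rfl <;> cases a <;>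
      simp only [fractions]
    · exact ⟨k, by push_cast; ring⟩
    · exact ⟨0, by simp⟩
    · exact ⟨2 * k, by push_cast; ring⟩
    · exact ⟨0, by simp⟩
    · exact ⟨0, by simp⟩
    · exact ⟨3 * k, by push_cast; ring⟩
    · exact ⟨0, by simp⟩
    · exact ⟨3 * k, by push_cast; ring⟩
    · exact ⟨0, by simp⟩

/-- A type profile with `m` friendly and `2 * m` contingent agents. -/
def mixedProfile (m : ℕ) (t : Fin (3 * m)) : AgentType :=
  if t.val < m then AgentType.F else AgentType.C

/-- The type profile in which all agents are contingent. -/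
def contingentProfile (T : ℕ) (_ : Fin T) : AgentType := AgentType.C

theorem mixedProfile_eq_F_iff {m : ℕ} {t : Fin (3 * m)} :
    mixedProfile m t = AgentType.F ↔ t.val < m := by
  unfold mixedProfile; split_ifs with h <;> simp [h]

theorem typeCount_mixedProfile_F (m : ℕ) : typeCount (mixedProfile m) AgentType.F = m := by
  simp only [typeCount, mixedProfile_eq_F_iff]
  rw [Fin.card_filter_val_lt]; omega

theorem typeCount_mixedProfile_U (m : ℕ) : typeCount (mixedProfile m) AgentType.U = 0 := by
  rw [typeCount, Finset.card_eq_zero, Finset.filter_eq_empty_iff]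
  intro t _; unfold mixedProfile; split_ifs <;> simp

theorem typeCount_mixedProfile_C (m : ℕ) : typeCount (mixedProfile m) AgentType.C = 2 * m := by
  have h := Finset.card_filter_add_card_filter_not (s := Finset.univ)
    fun t : Fin (3 * m) => mixedProfile m t = AgentType.F
  have hF := typeCount_mixedProfile_F m
  have e : (Finset.univ.filter fun t : Fin (3 * m) => ¬ mixedProfile m t = AgentType.F) =
      Finset.univ.filter fun t => mixedProfile m t = AgentType.C := by
    ext t; simp [mixedProfile]
  rw [e, Finset.card_univ, Fintype.card_fin] at h
  rw [typeCount] at hF ⊢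
  omega

theorem typeFraction_mixedProfile {m : ℕ} (hm : m ≠ 0) :
    (fun a => (typeCount (mixedProfile m) a : ℝ) / (3 * m : ℕ)) =
      fractions (1 / 3) 0 (2 / 3) := by
  have hm' : (m : ℝ) ≠ 0 := by exact_mod_cast hm
  funext a
  cases a
  · rw [typeCount_mixedProfile_F, fractions]; push_cast; field_simp
  · rw [typeCount_mixedProfile_U, fractions]; simp
  · rw [typeCount_mixedProfile_C, fractions]; push_cast; field_simp

theorem typeFraction_contingentProfile {T : ℕ} (hT : T ≠ 0) :
    (fun a => (typeCount (contingentProfile T) a : ℝ) / T) = fractions 0 0 1 := by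
  have hT' : (T : ℝ) ≠ 0 := by exact_mod_cast hT
  funext a
  cases a <;> simp [typeCount, contingentProfile, fractions, hT']

theorem majorityWish_mixedProfile (m : ℕ) :
    confusingSetting.majorityWish (mixedProfile m) World.L = Outcome.R := by
  have e : (Finset.univ.filter fun t : Fin (3 * m) =>
      confusingSetting.value (mixedProfile m t) World.L Outcome.R <
        confusingSetting.value (mixedProfile m t) World.L Outcome.A) =
      Finset.univ.filter fun t => mixedProfile m t = AgentType.F := by
    ext t; by_cases ht : t.val < m <;> simp [mixedProfile, ht, confusingSetting]
  have h := typeCount_mixedProfile_F m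
  rw [typeCount] at h
  rw [Setting.majorityWish, e, h, if_neg (by omega)]

theorem majorityWish_contingentProfile {T : ℕ} (hT : T ≠ 0) :
    confusingSetting.majorityWish (contingentProfile T) World.H = Outcome.A := by
  have e : (Finset.univ.filter fun t : Fin T =>
      confusingSetting.value (contingentProfile T t) World.H Outcome.R <
        confusingSetting.value (contingentProfile T t) World.H Outcome.A) = Finset.univ := by
    ext t; simp [contingentProfile, confusingSetting]
  rw [Setting.majorityWish, e, Finset.card_univ, Fintype.card_fin, if_pos (by omega)]

/-- A friendly agent knows the numbers of agents of each type, since only one vector of fractions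
in the support of the prior allows for friendly agents. -/
theorem typeCount_eq_of_friendly {m : ℕ} (hm : m ≠ 0) {θ : Fin (3 * m) → AgentType}
    {t : Fin (3 * m)} (ht : θ t = AgentType.F)
    (hθ : confusingSetting.typeProfileProb θ ≠ 0) : typeCount θ = typeCount (mixedProfile m) := by
  have hT : ((3 * m : ℕ) : ℝ) ≠ 0 := by exact_mod_cast (by omega : 3 * m ≠ 0)
  have hF : (typeCount θ AgentType.F : ℝ) / (3 * m : ℕ) ≠ 0 := by
    refine div_ne_zero ?_ hT
    rw [Nat.cast_ne_zero, typeCount]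
    exact (Finset.card_pos.2 ⟨t, by simp [ht]⟩).ne'
  have hmem : (fun a => (typeCount θ a : ℝ) / (3 * m : ℕ)) ∈
      confusingSetting.typePrior.support := by
    rw [PMF.mem_support_iff]
    intro h0
    exact hθ (by rw [Setting.typeProfileProb, h0]; simp)
  rcases mem_support_confusingSetting_iff.1 hmem with h | h | h
  · rw [← typeFraction_mixedProfile hm] at h
    funext a
    have := (div_left_inj' hT).1 (congrFun h a)
    exact_mod_cast this
  · exact absurd (congrFun h AgentType.F) hF
  · exact absurd (congrFun h AgentType.F) hF

/-- Every agent can be friendly: move a friendly agent of `mixedProfile m` to position `t`. -/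
theorem ownTypeProb_friendly_ne_zero {m : ℕ} (hm : m ≠ 0) (t : Fin (3 * m)) :
    confusingSetting.ownTypeProb t AgentType.F ≠ 0 := by
  let t₀ : Fin (3 * m) := ⟨0, by omega⟩
  let θ : Fin (3 * m) → AgentType := fun x => mixedProfile m (Equiv.swap t t₀ x)
  have ht : θ t = AgentType.F := by
    simp only [θ, Equiv.swap_apply_left, mixedProfile_eq_F_iff]
    exact Nat.pos_of_ne_zero hm
  have hc : typeCount θ = typeCount (mixedProfile m) := by
    funext a; exact Finset.card_equiv (Equiv.swap t t₀) (by simp [θ])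
  have hp : 0 < confusingSetting.typeProfileProb θ := by
    unfold Setting.typeProfileProb
    rw [hc, typeFraction_mixedProfile hm]
    refine div_pos (lt_of_lt_of_le (by norm_num) (one_third_le_typePrior
      (mem_support_confusingSetting_iff.2 (Or.inl rfl)))) ?_
    exact_mod_cast Finset.card_pos.2 ⟨mixedProfile m, by simp⟩
  refine (lt_of_lt_of_le hp ?_).ne'
  exact Finset.single_le_sum (f := confusingSetting.typeProfileProb)
    (fun θ _ => confusingSetting.typeProfileProb_nonneg θ) (by simp [ht])

/-! ### The deviation of the friendly agents -/

/-- Under an anonymous mechanism and a symmetric profile, if all agents are contingent, then the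
probability of rejection depends on the signals only through the number of high ones. -/
theorem exists_rejectGiven_eq_apply_highCount {M : Mechanism T R} (hM : M.Anonymous)
    {σ : Fin T → Strategy R} (hσ : IsSymmetric σ) :
    ∃ φ : ℕ → ℝ, (∀ n, 0 ≤ φ n) ∧
      ∀ s, 1 - acceptGiven M σ (contingentProfile T) s = φ (highCount s) := by
  classical
  refine ⟨fun n => if h : ∃ s : Fin T → Signal, highCount s = n then
    1 - acceptGiven M σ (contingentProfile T) h.choose else 0, fun n => ?_, fun s => ?_⟩
  · dsimp only
    split_ifs
    · exact sub_nonneg.2 (acceptGiven_le_one _ _ _ _)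
    · exact le_rfl
  · have h : ∃ s' : Fin T → Signal, highCount s' = highCount s := ⟨s, rfl⟩
    obtain ⟨π, hπ⟩ := exists_perm_of_highCount_eq h.choose_spec
    dsimp only
    rw [dif_pos h, ← acceptGiven_comp_perm hM hσ (contingentProfile T) s π, ← funext hπ]
    rfl

/-- The strategy profile in which friendly agents report, whatever their signal, what a contingent
agent with a high signal reports, and all others follow `σ`. -/
def mimicHigh (σ : Fin T → Strategy R) : Fin T → Strategy R :=
  fun t a m => if a = AgentType.F then σ t AgentType.C Signal.hi else σ t a m

theorem isSymmetric_mimicHigh {σ : Fin T → Strategy R} (hσ : IsSymmetric σ) :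
    IsSymmetric (mimicHigh σ) := fun t t' => by
  unfold mimicHigh; rw [hσ t t']

theorem acceptGiven_mimicHigh {m : ℕ} (M : Mechanism (3 * m) R) (σ : Fin (3 * m) → Strategy R)
    (s : Fin (3 * m) → Signal) :
    acceptGiven M (mimicHigh σ) (mixedProfile m) s =
      acceptGiven M σ (contingentProfile (3 * m))
        (fun t => if mixedProfile m t = AgentType.F then Signal.hi else s t) := by
  unfold acceptGiven
  congr 2
  funext t
  unfold mimicHigh mixedProfile contingentProfile
  split_ifs <;> simp_all

/-- If friendly agents imitate high signals, then in world `L` rejection is at most `3 / 2` times as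
likely as it is in world `H` with contingent agents only. -/
theorem one_sub_acceptIn_mimicHigh_le {m : ℕ} (hm : Odd m) {M : Mechanism (3 * m) R}
    (hM : M.Anonymous) {σ : Fin (3 * m) → Strategy R} (hσ : IsSymmetric σ) :
    1 - confusingSetting.acceptIn M (mimicHigh σ) (mixedProfile m) World.L ≤
      3 / 2 * (1 - confusingSetting.acceptIn M σ (contingentProfile (3 * m)) World.H) := by
  obtain ⟨φ, hφ, h⟩ := exists_rejectGiven_eq_apply_highCount hM hσ
  rw [Setting.one_sub_acceptIn, Setting.one_sub_acceptIn]
  simp only [acceptGiven_mimicHigh, h]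
  exact sum_raise_le hm (fun t => mixedProfile m t = AgentType.F) (typeCount_mixedProfile_F m)
    rfl rfl rfl rfl hφ

theorem utility_friendly {m : ℕ} (hm : m ≠ 0) {M : Mechanism (3 * m) R} (hM : M.Anonymous)
    {σ : Fin (3 * m) → Strategy R} (hσ : IsSymmetric σ) (t : Fin (3 * m)) :
    confusingSetting.utility M σ t AgentType.F =
      9 / 10 * (1 + confusingSetting.acceptIn M σ (mixedProfile m) World.L) +
        3 / 10 * confusingSetting.acceptIn M σ (mixedProfile m) World.H := by
  rw [Setting.utility_eq _ hM hσ (ownTypeProb_friendly_ne_zero hm t)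
    fun θ ht hθ => typeCount_eq_of_friendly hm ht hθ, sum_world]
  simp only [show confusingSetting.worldProb World.L = 9 / 10 from rfl,
    show confusingSetting.worldProb World.H = 1 / 10 from rfl,
    show confusingSetting.value AgentType.F World.L Outcome.A = 2 from rfl,
    show confusingSetting.value AgentType.F World.L Outcome.R = 1 from rfl,
    show confusingSetting.value AgentType.F World.H Outcome.A = 3 from rfl,
    show confusingSetting.value AgentType.F World.H Outcome.R = 0 from rfl]
  push_cast
  ring

theorem utility_mimicHigh_gt {m : ℕ} (hm : Odd m) {M : Mechanism (3 * m) R} (hM : M.Anonymous)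
    {σ : Fin (3 * m) → Strategy R} (hσ : IsSymmetric σ)
    (hs : 1 - 1 / 1000 < confusingSetting.successProb M σ) (t : Fin (3 * m)) :
    confusingSetting.utility M σ t AgentType.F + 1 / 1000 <
      confusingSetting.utility M (mimicHigh σ) t AgentType.F := by
  have hm0 : m ≠ 0 := hm.pos.ne'
  have hT : 3 * m ≠ 0 := by omega
  have h1 := confusingSetting.prior_mul_failIn_le hT hM hσ (mixedProfile m) World.L
  have h2 := confusingSetting.prior_mul_failIn_le hT hM hσ (contingentProfile (3 * m)) World.H
  have p1 := one_third_le_typePrior (mem_support_confusingSetting_iff.2 (Or.inl rfl))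
  have p2 := one_third_le_typePrior (mem_support_confusingSetting_iff.2 (Or.inr (Or.inl rfl)))
  rw [typeFraction_mixedProfile hm0, Setting.failIn, majorityWish_mixedProfile,
    if_neg (by decide), show confusingSetting.worldProb World.L = 9 / 10 from rfl] at h1
  rw [typeFraction_contingentProfile hT, Setting.failIn, majorityWish_contingentProfile hT,
    if_pos rfl, show confusingSetting.worldProb World.H = 1 / 10 from rfl] at h2
  have key := one_sub_acceptIn_mimicHigh_le hm hM hσ
  have a1 := confusingSetting.acceptIn_nonneg M σ (mixedProfile m) World.L
  have a2 := confusingSetting.acceptIn_le_one M σ (contingentProfile (3 * m)) World.H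
  have a3 := confusingSetting.acceptIn_le_one M σ (mixedProfile m) World.H
  have a4 := confusingSetting.acceptIn_nonneg M (mimicHigh σ) (mixedProfile m) World.H
  have b1 := (mul_le_mul_of_nonneg_right p1 (by positivity)).trans h1
  have b2 := (mul_le_mul_of_nonneg_right p2
    (mul_nonneg (by norm_num) (sub_nonneg.2 a2))).trans h2
  rw [utility_friendly hm0 hM hσ, utility_friendly hm0 hM (isSymmetric_mimicHigh hσ)]
  linarith

end Voting

end

open Voting in
theorem theorem5 :
    ∃ τ : ℝ, 0 < τ ∧ ∃ I : Setting,
      (∀ N : ℕ, ∃ T : ℕ, N ≤ T ∧ Odd T ∧ I.Feasible T) ∧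
      ∀ T : ℕ, Odd T → I.Feasible T →
        ∀ (R : Type*) [MeasurableSpace R] (M : Mechanism T R), M.Anonymous →
          ∀ σ : Fin T → Strategy R, IsSymmetric σ → I.IsStrongBNE M τ σ →
            ¬ (1 - τ < I.successProb M σ) := by
  refine ⟨1 / 1000, by norm_num, confusingSetting, fun N => ?_, ?_⟩
  · exact ⟨3 * (2 * N + 1), by omega, ⟨3 * N + 1, by ring⟩,
      confusingSetting_feasible_iff.2 (dvd_mul_right _ _)⟩
  · intro T hodd hfeas R _ M hM σ hσ hne hs
    obtain ⟨m, rfl⟩ := confusingSetting_feasible_iff.1 hfeas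
    have hm : Odd m := (Nat.odd_mul.1 hodd).2
    have hgt := utility_mimicHigh_gt hm hM hσ hs
    -- the coalition of all agents when friendly
    refine hne ⟨{x | x.2 = AgentType.F}, mimicHigh σ, fun t a ha => ?_, fun t a ha => ?_,
      ⟨0, Nat.mul_pos three_pos hm.pos⟩, AgentType.F, rfl, hgt _⟩
    · funext m
      exact (if_neg ha).symm
    · obtain rfl : a = AgentType.F := ha
      linarith [hgt t]
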